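/- Let $n,N$ be natural numbers, let $dV$ be Lebesgue measure on $\mathbb{C}^n$ and $d\mu(z)=\pi^{-n}e^{-|z|^2}dV(z)$, where $z\cdot\overline{w}=\sum_k z_k\overline{w_k}$ and $|z|^2=z\cdot\overline z$. Let $K(w,z)=e^{w\cdot\overline z}$, $k(w,z)=K(w,z)/\sqrt{K(z,z)}$, and let $$\mathcal{B}[u](z)=\int_{\mathbb{C}^n}u(w)\,|k(w,z)|^2\,d\mu(w)$$ be the Berezin transform of $u\in L^2(\mathbb{C}^n,d\mu)$. Let $\mathrm{Sym}(\mathbb{C}^n)$ be the set of measurable functions $h:\mathbb{C}^n\to\mathbb{C}$ such that $h(z)e^{-c|z|^2}$ is essentially bounded for every $c>0$. For an entire function $h$ put $h^*(z)=\overline{h(\overline z)}$. For entire functions $f$ and $g$ with $g(z)=\sum_i a_iz^i$ (sum over multi-indices $i\in\mathbb{N}^n$), so that $g^*(z)=\sum_i\overline{a_i}z^i$, put $$g^*(\overline\zeta-\partial_\zeta)f(\zeta)=\sum_i\overline{a_i}\,(\overline{\zeta}-\partial_\zeta)^if(\zeta),\qquad (\overline{\zeta}-\partial_\zeta)^i=\prod_{k=1}^n(\overline{\zeta_k}-\partial_{\zeta_k})^{i_k},$$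 whenever the series converges absolutely, where $\partial_{\zeta_k}=\frac12(\partial_{x_k}-\mathrm{i}\,\partial_{y_k})$ for $\zeta_k=x_k+\mathrm{i}y_k$. Let $f_l,g_l\in\mathrm{Sym}(\mathbb{C}^n)$ be entire functions, $l=1,\dots,N$. Then for each $l$ the series defining $g_l^*(\overline\zeta-\partial_\zeta)f_l(\zeta)$ converges absolutely at every $\zeta\in\mathbb{C}^n$, and: (1) If $u\in L^2(\mathbb{C}^n,d\mu)$ satisfies $\mathcal{B}[u]=\sum_{l=1}^Nf_l\overline{g_l}$ on $\mathbb{C}^n$, then $$u(\zeta)=\sum_{l=1}^N g_l^*(\overline\zeta-\partial_\zeta)f_l(\zeta)\quad\text{for almost every }\zeta\in\mathbb{C}^n.$$ (2) Conversely, the function $\zeta\mapsto\sum_{l=1}^N g_l^*(\overline\zeta-\partial_\zeta)f_l(\zeta)$ belongs to $L^2(\mathbb{C}^n,d\mu)$ and its Berezin transform equals $\sum_{l=1}^Nf_l\overline{g_l}$ on $\mathbb{C}^n$. -/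

import Mathlib

open MeasureTheory
open scoped ComplexConjugate

namespace Fock

noncomputable section

/-- `z · w̄ = ∑ zᵢ w̄ᵢ` on `ℂⁿ`. -/
def herm {n : ℕ} (z w : Fin n → ℂ) : ℂ := ∑ i, z i * conj (w i)

/-- The square `|z|² = ∑ |zᵢ|²` of the Euclidean norm on `ℂⁿ`
(the norm that Mathlib puts on `Fin n → ℂ` is the sup norm, which is not used). -/
def absSq {n : ℕ} (z : Fin n → ℂ) : ℝ := ∑ i, ‖z i‖ ^ 2

/-- The Gaussian measure `dμ(z) = π⁻ⁿ exp (-|z|²) dV(z)`. -/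
def gaussian (n : ℕ) : Measure (Fin n → ℂ) :=
  volume.withDensity fun z => ENNReal.ofReal ((Real.pi ^ n)⁻¹ * Real.exp (-absSq z))

/-- The reproducing kernel `K(w, z) = exp (w · z̄)` of the Fock space. -/
def kernel {n : ℕ} (w z : Fin n → ℂ) : ℂ := Complex.exp (herm w z)

/-- The normalized kernel `k(w, z) = K(w, z) / √K(z, z)`; the number `K(z, z)` is positive real. -/
def normKernel {n : ℕ} (w z : Fin n → ℂ) : ℂ :=
  kernel w z / ((Real.sqrt (kernel z z).re : ℝ) : ℂ)

/-- The Berezin transform `B[u](z) = ⟨u k(·, z), k(·, z)⟩` in `L²(ℂⁿ, dμ)`. -/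
def berezin {n : ℕ} (u : (Fin n → ℂ) → ℂ) (z : Fin n → ℂ) : ℂ :=
  ∫ w, u w * normKernel w z * conj (normKernel w z) ∂(gaussian n)

/-- The space `D_c` of measurable `u` such that `u(z) exp (-c |z|²)` is essentially bounded. -/
def growthSpace (n : ℕ) (c : ℝ) : Set ((Fin n → ℂ) → ℂ) :=
  {u | Measurable u ∧ ∃ C : ℝ, ∀ᵐ z : Fin n → ℂ, ‖u z‖ * Real.exp (-(c * absSq z)) ≤ C}

/-- The symbol space `Sym(ℂⁿ) = ⋂_{c > 0} D_c`. -/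
def symSpace (n : ℕ) : Set ((Fin n → ℂ) → ℂ) := ⋂ (c : ℝ) (_ : 0 < c), growthSpace n c

/-- `H(ℂⁿ) ∩ Sym(ℂⁿ)`. -/
def entireSym (n : ℕ) : Set ((Fin n → ℂ) → ℂ) := {h | Differentiable ℂ h} ∩ symSpace n

/-- `h*(z)`, the conjugate of `h(z̄)`. -/
def conjStar {n : ℕ} (h : (Fin n → ℂ) → ℂ) (z : Fin n → ℂ) : ℂ := conj (h fun i => conj (z i))

/-- The Wirtinger derivative `∂ₖ = (∂/∂xₖ - i ∂/∂yₖ) / 2`. On holomorphic functions it is the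
complex partial derivative in the `k`-th variable; it is also defined on real differentiable
functions such as `ζ̄ₖ h(ζ)`. -/
def dz {n : ℕ} (k : Fin n) (h : (Fin n → ℂ) → ℂ) (z : Fin n → ℂ) : ℂ :=
  (fderiv ℝ h z (Pi.single k 1) - Complex.I * fderiv ℝ h z (Pi.single k Complex.I)) / 2

/-- The operator `ζ̄ₖ - ∂ₖ`. -/
def conjSubDz {n : ℕ} (k : Fin n) (h : (Fin n → ℂ) → ℂ) (z : Fin n → ℂ) : ℂ :=
  conj (z k) * h z - dz k h z

/-- The multi-index power `A^i = A₁^{i₁} ⋯ Aₙ^{iₙ}` of an `n`-tuple of operators on functions. -/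
def multiPow {n : ℕ} (A : Fin n → ((Fin n → ℂ) → ℂ) → ((Fin n → ℂ) → ℂ)) (i : Fin n → ℕ)
    (h : (Fin n → ℂ) → ℂ) : (Fin n → ℂ) → ℂ :=
  (List.finRange n).foldr (fun k v => (A k)^[i k] v) h

/-- The Taylor coefficient `∂^i h(0) / i!` at the origin. -/
def taylorCoeff {n : ℕ} (h : (Fin n → ℂ) → ℂ) (i : Fin n → ℕ) : ℂ :=
  multiPow dz i h 0 / ((∏ k, (i k).factorial : ℕ) : ℂ)

/-- The term of multi-index `i` in the series defining `G(ζ̄ - ∂_ζ) f(ζ)`. -/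
def opTerm {n : ℕ} (G f : (Fin n → ℂ) → ℂ) (ζ : Fin n → ℂ) (i : Fin n → ℕ) : ℂ :=
  taylorCoeff G i * multiPow conjSubDz i f ζ

/-- `G(ζ̄ - ∂_ζ) f(ζ) = ∑_i b_i (ζ̄ - ∂_ζ)^i f(ζ)` where `G(z) = ∑_i b_i z^i` is the Taylor
series of `G` at the origin. -/
def opApply {n : ℕ} (G f : (Fin n → ℂ) → ℂ) (ζ : Fin n → ℂ) : ℂ := ∑' i, opTerm G f ζ i

end

end Fock

/-!
The solution of `B[u] = f ḡ` is the Gaussian integral `u(ζ) = ∫ f(ζ - x) conj (g(ζ + x)) dμ(x)`.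
The Berezin transform is the average over translates, `B[u](z) = ∫ u(z + v) dμ(v)`, and the
orthogonal map `(v, x) ↦ ((v + x) / √2, (v - x) / √2)` preserves `μ ⊗ μ`, so that `B[u](z)`
separates into the Gaussian averages of `f(z + √2 x)` and `conj (g(z + √2 v))`, which are `f(z)` and
`conj (g(z))` by the mean value property. The parallelogram law
`|ζ - x|² + |ζ + x|² = 2 |ζ|² + 2 |x|²` turns the growth bounds on `f` and `g` into `u ∈ L²(μ)`.

For the series, `∂_ζ` does not act on `ζ̄`, so `(ζ̄ - ∂_ζ)^i f(ζ)` is the `i`-th derivative at `0`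
of `H(x) = f(ζ - x) e^{x·ζ̄}`. The series is therefore the expansion in monomials of the Fock space
pairing `⟨H, g⟩`, and it equals `u(ζ)` because multiplication by `e^{x·ζ̄}` is adjoint to the
translation of `g` by `ζ`.

For uniqueness, `B[u] = 0` says that all exponential moments of `u dμ` vanish, and exponential
moments determine a finite measure.
-/

namespace Fock

open Asymptotics ProbabilityTheory
open scoped ContDiff

variable {n : ℕ}

section Elementary

lemma absSq_nonneg (z : Fin n → ℂ) : 0 ≤ absSq z := Finset.sum_nonneg fun _ _ => sq_nonneg _

@[fun_prop]
lemma continuous_absSq : Continuous (absSq : (Fin n → ℂ) → ℝ) := by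
  unfold absSq; fun_prop

@[fun_prop]
lemma continuous_herm {X : Type*} [TopologicalSpace X] {a b : X → Fin n → ℂ}
    (ha : Continuous a) (hb : Continuous b) : Continuous fun x => herm (a x) (b x) := by
  unfold herm; fun_prop

lemma absSq_neg (z : Fin n → ℂ) : absSq (-z) = absSq z := by simp [absSq]

lemma absSq_real_smul (t : ℝ) (z : Fin n → ℂ) : absSq (t • z) = t ^ 2 * absSq z := by
  simp [absSq, mul_pow, Finset.mul_sum]

lemma herm_add_left (a b c : Fin n → ℂ) : herm (a + b) c = herm a c + herm b c := by
  simp [herm, add_mul, Finset.sum_add_distrib]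

lemma herm_add_right (a b c : Fin n → ℂ) : herm a (b + c) = herm a b + herm a c := by
  simp [herm, mul_add, Finset.sum_add_distrib]

lemma herm_real_smul_right (t : ℝ) (a b : Fin n → ℂ) : herm a (t • b) = t * herm a b := by
  simp [herm, Finset.mul_sum, mul_left_comm]

lemma herm_zero_left (b : Fin n → ℂ) : herm 0 b = 0 := by
  simp [herm]

lemma conj_herm (a b : Fin n → ℂ) : conj (herm a b) = herm b a := by
  simp [herm, mul_comm]

lemma herm_self (z : Fin n → ℂ) : herm z z = (absSq z : ℂ) := by
  simp [herm, absSq, Complex.mul_conj, Complex.normSq_eq_norm_sq]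

lemma absSq_add (z w : Fin n → ℂ) :
    absSq (z + w) = absSq z + absSq w + 2 * (herm w z).re := by
  have h : herm z w + herm w z = ((2 * (herm w z).re : ℝ) : ℂ) := by
    rw [← conj_herm w z, add_comm, Complex.add_conj]
  rw [← Complex.ofReal_inj]
  push_cast [← herm_self] at h ⊢
  rw [herm_add_left, herm_add_right, herm_add_right, ← h]
  ring

lemma absSq_sub_add_absSq_add (z w : Fin n → ℂ) :
    absSq (z - w) + absSq (z + w) = 2 * absSq z + 2 * absSq w := by
  simp only [absSq, Pi.sub_apply, Pi.add_apply, ← Complex.normSq_eq_norm_sq, Complex.normSq_sub,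
    Complex.normSq_add, Finset.mul_sum, ← Finset.sum_add_distrib]
  exact Finset.sum_congr rfl fun _ _ => by ring

lemma sum_norm_mul_norm_le {ε : ℝ} (hε : 0 < ε) (a b : Fin n → ℂ) :
    ∑ k, ‖a k‖ * ‖b k‖ ≤ ε * absSq a + (4 * ε)⁻¹ * absSq b := by
  unfold absSq
  rw [Finset.mul_sum, Finset.mul_sum, ← Finset.sum_add_distrib]
  refine Finset.sum_le_sum fun k _ => ?_
  have hsq : 0 ≤ (4 * ε)⁻¹ * (2 * ε * ‖a k‖ - ‖b k‖) ^ 2 := by positivity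
  have hexpand : (4 * ε)⁻¹ * (2 * ε * ‖a k‖ - ‖b k‖) ^ 2
      = ε * ‖a k‖ ^ 2 - ‖a k‖ * ‖b k‖ + (4 * ε)⁻¹ * ‖b k‖ ^ 2 := by
    field_simp; ring
  linarith

lemma norm_herm_le (a b : Fin n → ℂ) : ‖herm a b‖ ≤ ∑ k, ‖a k‖ * ‖b k‖ :=
  (norm_sum_le _ _).trans_eq <| Finset.sum_congr rfl fun k _ => by simp

end Elementary

section Growth

variable {E F : Type*} [NormedAddCommGroup E] [NormedAddCommGroup F]

/-- `φ` has Gaussian growth of exponent less than `c`: `‖φ w‖ ≤ C exp (c' |w|²)` everywhere, for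
some `C` and some `c' < c`. The strict inequality makes this class of functions stable under
translations and under multiplication by exponentials of linear forms. -/
def GrowthLT (c : ℝ) (φ : (Fin n → ℂ) → E) : Prop :=
  ∃ c' < c, φ =O[⊤] fun w => Real.exp (c' * absSq w)

namespace GrowthLT

variable {c d : ℝ} {φ : (Fin n → ℂ) → E} {ψ : (Fin n → ℂ) → F}

lemma mono (hφ : GrowthLT c φ) (hcd : c ≤ d) : GrowthLT d φ :=
  let ⟨c', hc', h⟩ := hφ
  ⟨c', hc'.trans_le hcd, h⟩

lemma of_isBigO (hφ : GrowthLT c φ) (h : ψ =O[⊤] φ) : GrowthLT c ψ :=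
  let ⟨c', hc', hO⟩ := hφ
  ⟨c', hc', h.trans hO⟩

lemma of_norm_le (hφ : GrowthLT c φ) (h : ∀ w, ‖ψ w‖ ≤ ‖φ w‖) : GrowthLT c ψ :=
  hφ.of_isBigO (isBigO_of_le _ h)

lemma norm (hφ : GrowthLT c φ) : GrowthLT c fun w => ‖φ w‖ := hφ.of_norm_le fun w => by simp

lemma conjugate {φ : (Fin n → ℂ) → ℂ} (hφ : GrowthLT c φ) : GrowthLT c fun w => conj (φ w) :=
  hφ.of_norm_le fun w => by simp

lemma mul {R : Type*} [NormedRing R] {φ ψ : (Fin n → ℂ) → R}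
    (hφ : GrowthLT c φ) (hψ : GrowthLT d ψ) : GrowthLT (c + d) fun w => φ w * ψ w := by
  obtain ⟨c', hc', hφ⟩ := hφ
  obtain ⟨d', hd', hψ⟩ := hψ
  refine ⟨c' + d', add_lt_add hc' hd', (hφ.mul hψ).congr_right fun w => ?_⟩
  rw [← Real.exp_add, add_mul]

lemma exists_lt (hφ : GrowthLT c φ) : ∃ c' < c, GrowthLT c' φ :=
  let ⟨c', hc', h⟩ := hφ
  let ⟨c'', hc'', hc⟩ := exists_between hc'
  ⟨c'', hc, c', hc'', h⟩

lemma mul_of_forall_pos {R : Type*} [NormedRing R] {φ ψ : (Fin n → ℂ) → R}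
    (hφ : GrowthLT c φ) (hψ : ∀ δ > 0, GrowthLT δ ψ) : GrowthLT c fun w => φ w * ψ w := by
  obtain ⟨c', hc', hφ⟩ := hφ.exists_lt
  simpa using hφ.mul (hψ (c - c') (sub_pos.2 hc'))

lemma comp_smul {t : ℝ} (ht : t ≠ 0) (hφ : GrowthLT c φ) :
    GrowthLT (c * t ^ 2) fun w => φ (t • w) := by
  obtain ⟨c', hc', h⟩ := hφ
  refine ⟨c' * t ^ 2, by gcongr, (h.comp_tendsto Filter.tendsto_top).congr_right fun w => ?_⟩
  rw [Function.comp_apply, absSq_real_smul, mul_assoc]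

end GrowthLT

lemma growthLT_exp_mul_absSq {c' c : ℝ} (h : c' < c) :
    GrowthLT c fun w : Fin n → ℂ => Real.exp (c' * absSq w) :=
  ⟨c', h, isBigO_refl _ _⟩

lemma growthLT_exp_sum_norm_mul_norm (a : Fin n → ℂ) {δ : ℝ} (hδ : 0 < δ) :
    GrowthLT δ fun w : Fin n → ℂ => Real.exp (∑ k, ‖w k‖ * ‖a k‖) := by
  refine ⟨δ / 2, half_lt_self hδ, .of_bound (Real.exp ((4 * (δ / 2))⁻¹ * absSq a)) <|
    .of_forall fun w => ?_⟩
  rw [Real.norm_of_nonneg (Real.exp_pos _).le, Real.norm_of_nonneg (Real.exp_pos _).le,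
    ← Real.exp_add, add_comm]
  exact Real.exp_le_exp.2 (sum_norm_mul_norm_le (half_pos hδ) w a)

lemma growthLT_cexp {h : (Fin n → ℂ) → ℂ} (a : Fin n → ℂ)
    (hh : ∀ w, ‖h w‖ ≤ ∑ k, ‖w k‖ * ‖a k‖) {δ : ℝ} (hδ : 0 < δ) :
    GrowthLT δ fun w => Complex.exp (h w) :=
  (growthLT_exp_sum_norm_mul_norm a hδ).of_norm_le fun w => by
    rw [Real.norm_of_nonneg (Real.exp_pos _).le]
    exact (Complex.norm_exp_le_exp_norm _).trans (Real.exp_le_exp.2 (hh w))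

lemma growthLT_cexp_herm_left (a : Fin n → ℂ) {δ : ℝ} (hδ : 0 < δ) :
    GrowthLT δ fun w => Complex.exp (herm w a) :=
  growthLT_cexp a (fun w => norm_herm_le w a) hδ

lemma growthLT_cexp_herm_right (a : Fin n → ℂ) {δ : ℝ} (hδ : 0 < δ) :
    GrowthLT δ fun w => Complex.exp (herm a w) :=
  growthLT_cexp a (fun w => by rw [← conj_herm w a, Complex.norm_conj]; exact norm_herm_le w a) hδ

lemma growthLT_id {δ : ℝ} (hδ : 0 < δ) : GrowthLT δ fun w : Fin n → ℂ => w := by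
  refine (growthLT_exp_sum_norm_mul_norm 1 hδ).of_norm_le fun w => ?_
  have hnorm : ‖w‖ ≤ ∑ k, ‖w k‖ :=
    (pi_norm_le_iff_of_nonneg (by positivity)).2 fun k =>
      Finset.single_le_sum (f := fun k => ‖w k‖) (fun _ _ => norm_nonneg _) (Finset.mem_univ k)
  rw [Real.norm_of_nonneg (Real.exp_pos _).le]
  simp only [Pi.one_apply, norm_one, mul_one]
  linarith [Real.add_one_le_exp (∑ k, ‖w k‖)]

namespace GrowthLT

variable {c : ℝ} {φ : (Fin n → ℂ) → E}

lemma comp_add_left (hφ : GrowthLT c φ) (z : Fin n → ℂ) : GrowthLT c fun w => φ (z + w) := by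
  obtain ⟨c', hc', h⟩ := hφ
  have hexp : ∀ δ > 0, GrowthLT δ fun w : Fin n → ℂ => Real.exp (2 * c' * (herm w z).re) :=
    fun δ hδ => (growthLT_cexp_herm_left ((2 * c') • z) hδ).of_norm_le fun w => by
      rw [Complex.norm_exp, Real.norm_of_nonneg (Real.exp_pos _).le, herm_real_smul_right,
        Complex.re_ofReal_mul]
  refine ((growthLT_exp_mul_absSq hc').mul_of_forall_pos hexp).of_isBigO <|
    (h.comp_tendsto (k := (z + ·)) Filter.tendsto_top).trans <|
      .of_bound (Real.exp (c' * absSq z)) <| .of_forall fun w => le_of_eq ?_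
  rw [Function.comp_apply, ← Real.exp_add, Real.norm_of_nonneg (Real.exp_pos _).le,
    Real.norm_of_nonneg (Real.exp_pos _).le, ← Real.exp_add, absSq_add]
  ring_nf

lemma comp_sub_left (hφ : GrowthLT c φ) (z : Fin n → ℂ) : GrowthLT c fun w => φ (z - w) := by
  obtain ⟨c', hc', h⟩ := hφ.comp_add_left z
  refine ⟨c', hc', (h.comp_tendsto (k := Neg.neg) Filter.tendsto_top).congr (fun w => ?_)
    fun w => ?_⟩
  · simp [sub_eq_add_neg]
  · simp [absSq_neg]

lemma of_mem_growthSpace {h : (Fin n → ℂ) → ℂ} {c c' : ℝ} (hh : h ∈ growthSpace n c)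
    (hcont : Continuous h) (hc : c < c') : GrowthLT c' h := by
  obtain ⟨-, C, hC⟩ := hh
  refine ⟨c, hc, .of_bound C <| .of_forall ?_⟩
  have hdense : Dense {z : Fin n → ℂ | ‖h z‖ * Real.exp (-(c * absSq z)) ≤ C} :=
    Measure.dense_of_ae hC
  have hclosed : IsClosed {z : Fin n → ℂ | ‖h z‖ * Real.exp (-(c * absSq z)) ≤ C} :=
    isClosed_le (by fun_prop) continuous_const
  intro z
  have hz : ‖h z‖ * Real.exp (-(c * absSq z)) ≤ C :=
    hclosed.closure_eq.subset (hdense z)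
  rwa [Real.exp_neg, ← div_eq_mul_inv, div_le_iff₀ (Real.exp_pos _),
    ← Real.norm_of_nonneg (Real.exp_pos (c * absSq z)).le] at hz

end GrowthLT

end Growth

section MeasurePreserving

lemma measurePreserving_withDensity {α β : Type*} [MeasurableSpace α] [MeasurableSpace β]
    {μ : Measure α} {ν : Measure β} {T : α → β} (hT : MeasurePreserving T μ ν)
    {σ : α → ENNReal} {ρ : β → ENNReal} (hρ : Measurable ρ) (h : ∀ x, ρ (T x) = σ x) :
    MeasurePreserving T (μ.withDensity σ) (ν.withDensity ρ) := by
  obtain rfl : (fun x => ρ (T x)) = σ := funext h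
  refine ⟨hT.measurable, Measure.ext fun s hs => ?_⟩
  rw [Measure.map_apply hT.measurable hs, withDensity_apply _ hs,
    withDensity_apply _ (hT.measurable hs), ← hT.setLIntegral_comp_preimage hs hρ]

lemma measurePreserving_of_linear_involution {V : Type*} [NormedAddCommGroup V] [NormedSpace ℝ V]
    [MeasurableSpace V] [BorelSpace V] [FiniteDimensional ℝ V] (μ : Measure V)
    [μ.IsAddHaarMeasure] {L : V →ₗ[ℝ] V} (hL : Function.Involutive L) :
    MeasurePreserving L μ μ := by
  have hdet : LinearMap.det L * LinearMap.det L = 1 := by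
    rw [← LinearMap.det_comp, show L ∘ₗ L = LinearMap.id from LinearMap.ext hL, LinearMap.det_id]
  refine ⟨L.continuous_of_finiteDimensional.measurable, ?_⟩
  rw [Measure.map_linearMap_addHaar_eq_smul_addHaar μ (left_ne_zero_of_mul_eq_one hdet)]
  rcases mul_self_eq_one_iff.1 hdet with h | h <;> simp [h]

end MeasurePreserving

section Gaussian

lemma exp_mul_absSq_eq_prod (a : ℝ) (z : Fin n → ℂ) :
    Real.exp (a * absSq z) = ∏ k, Real.exp (a * ‖z k‖ ^ 2) := by
  rw [absSq, Finset.mul_sum, Real.exp_sum]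

lemma integrable_exp_mul_absSq_volume {a : ℝ} (ha : a < 0) :
    Integrable fun z : Fin n → ℂ => Real.exp (a * absSq z) := by
  simp_rw [exp_mul_absSq_eq_prod]
  refine Integrable.fintype_prod (f := fun _ (x : ℂ) => Real.exp (a * ‖x‖ ^ 2)) fun _ => ?_
  have := (GaussianFourier.integrable_cexp_neg_mul_sq_norm_add (V := ℂ) (b := -(a : ℂ))
    (by simpa) 0 0).norm
  simpa [Complex.norm_exp, ← Complex.ofReal_pow] using this

lemma integral_exp_neg_absSq_volume :
    ∫ z : Fin n → ℂ, Real.exp (-absSq z) = Real.pi ^ n := by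
  have hone : ∫ z : ℂ, Real.exp (-1 * ‖z‖ ^ 2) = Real.pi := by
    simpa using GaussianFourier.integral_rexp_neg_mul_sq_norm (V := ℂ) (b := 1) one_pos
  simp_rw [← neg_one_mul (absSq _), exp_mul_absSq_eq_prod,
    integral_fintype_prod_volume_eq_prod fun (_ : Fin n) (x : ℂ) => Real.exp (-1 * ‖x‖ ^ 2), hone]
  simp

lemma measurable_gaussian_density :
    Measurable fun z : Fin n → ℂ =>
      ENNReal.ofReal ((Real.pi ^ n)⁻¹ * Real.exp (-absSq z)) := by
  fun_prop

instance isProbabilityMeasure_gaussian : IsProbabilityMeasure (gaussian n) := by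
  have hint : Integrable fun z : Fin n → ℂ => Real.exp (-absSq z) := by
    simpa using integrable_exp_mul_absSq_volume (n := n) neg_one_lt_zero
  constructor
  rw [gaussian, withDensity_apply _ MeasurableSet.univ, Measure.restrict_univ,
    ← ofReal_integral_eq_lintegral_ofReal (hint.const_mul _) (.of_forall fun z => by positivity),
    integral_const_mul, integral_exp_neg_absSq_volume, inv_mul_cancel₀ (by positivity),
    ENNReal.ofReal_one]

lemma integrable_exp_mul_absSq {c : ℝ} (hc : c < 1) :
    Integrable (fun w : Fin n → ℂ => Real.exp (c * absSq w)) (gaussian n) := by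
  rw [gaussian, integrable_withDensity_iff_integrable_smul' measurable_gaussian_density (by simp)]
  refine ((integrable_exp_mul_absSq_volume (n := n) (sub_neg.2 hc)).const_mul
    (Real.pi ^ n)⁻¹).congr (.of_forall fun w => ?_)
  simp only [smul_eq_mul]
  rw [ENNReal.toReal_ofReal (by positivity), mul_assoc, ← Real.exp_add]
  ring_nf

lemma GrowthLT.integrable {E : Type*} [NormedAddCommGroup E] {φ : (Fin n → ℂ) → E}
    (hφ : GrowthLT 1 φ) (hm : AEStronglyMeasurable φ (gaussian n)) :
    Integrable φ (gaussian n) := by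
  obtain ⟨c, hc, hO⟩ := hφ
  obtain ⟨C, hC⟩ := Asymptotics.isBigO_top.1 hO
  exact ((integrable_exp_mul_absSq hc).norm.const_mul C).mono' hm (.of_forall hC)

lemma GrowthLT.memLp_two {E : Type*} [NormedAddCommGroup E] {φ : (Fin n → ℂ) → E}
    (hφ : GrowthLT (1 / 2) φ) (hm : AEStronglyMeasurable φ (gaussian n)) :
    MemLp φ 2 (gaussian n) := by
  refine (memLp_two_iff_integrable_sq_norm hm).2 ?_
  have hsq : GrowthLT 1 fun w => ‖φ w‖ * ‖φ w‖ := (hφ.norm.mul hφ.norm).mono (by norm_num)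
  simpa only [sq] using hsq.integrable (hm.norm.mul hm.norm)

lemma integral_gaussian_eq {E : Type*} [NormedAddCommGroup E] [NormedSpace ℝ E]
    (F : (Fin n → ℂ) → E) :
    ∫ w, F w ∂(gaussian n) = ∫ w, ((Real.pi ^ n)⁻¹ * Real.exp (-absSq w)) • F w := by
  rw [gaussian, integral_withDensity_eq_integral_toReal_smul measurable_gaussian_density
    (by simp)]
  congr with w
  rw [ENNReal.toReal_ofReal (by positivity)]

lemma integral_gaussian_translate (F : (Fin n → ℂ) → ℂ) (z : Fin n → ℂ) :
    ∫ w, F w ∂(gaussian n)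
      = ∫ v, F (z + v) * Complex.exp (-herm v z - herm z v - herm z z) ∂(gaussian n) := by
  rw [integral_gaussian_eq, integral_gaussian_eq, ← integral_add_left_eq_self _ z]
  congr with v
  simp only [Complex.real_smul, Complex.ofReal_mul, Complex.ofReal_exp, Complex.ofReal_neg,
    ← herm_self]
  have hdensity : Complex.exp (-herm (z + v) (z + v))
      = Complex.exp (-herm v v) * Complex.exp (-herm v z - herm z v - herm z z) := by
    rw [← Complex.exp_add]
    simp only [herm_add_left, herm_add_right]
    ring_nf
  rw [hdensity]; ring

lemma measurePreserving_smul_gaussian {c : ℂ} (hc : ‖c‖ = 1) :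
    MeasurePreserving (fun w : Fin n → ℂ => c • w) (gaussian n) (gaussian n) := by
  have hcoord : MeasurePreserving (fun w : ℂ => c * w) := by
    exact (rotation (⟨c, by simpa [Submonoid.unitSphere] using hc⟩ : Circle)).measurePreserving
  have hvol : MeasurePreserving (fun w : Fin n → ℂ => c • w) :=
    volume_preserving_pi fun _ => hcoord
  exact measurePreserving_withDensity hvol measurable_gaussian_density fun w => by
    simp [absSq, hc]

/-- The orthogonal involution `(v, x) ↦ ((v + x) / √2, (v - x) / √2)` of a product `V × V`. -/
noncomputable def hadamard (V : Type*) [AddCommGroup V] [Module ℝ V] : V × V →ₗ[ℝ] V × V :=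
  (√2)⁻¹ • (LinearMap.fst ℝ V V + LinearMap.snd ℝ V V).prod
    (LinearMap.fst ℝ V V - LinearMap.snd ℝ V V)

lemma hadamard_apply {V : Type*} [AddCommGroup V] [Module ℝ V] (p : V × V) :
    hadamard V p = ((√2)⁻¹ • (p.1 + p.2), (√2)⁻¹ • (p.1 - p.2)) := rfl

lemma hadamard_involutive (V : Type*) [AddCommGroup V] [Module ℝ V] :
    Function.Involutive (hadamard V) := by
  intro p
  have h : ((√2)⁻¹ : ℝ) * (√2)⁻¹ = 2⁻¹ := by
    rw [← mul_inv, Real.mul_self_sqrt zero_le_two]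
  simp only [hadamard_apply, ← smul_add, ← smul_sub, smul_smul, h]
  ext <;> simp only <;> module

lemma measurePreserving_hadamard_gaussian :
    MeasurePreserving (hadamard (Fin n → ℂ)) ((gaussian n).prod (gaussian n))
      ((gaussian n).prod (gaussian n)) := by
  have := Measure.prod.instIsAddHaarMeasure
    (volume : Measure (Fin n → ℂ)) (volume : Measure (Fin n → ℂ))
  have hvol := measurePreserving_of_linear_involution
    (Measure.prod (volume : Measure (Fin n → ℂ)) (volume : Measure (Fin n → ℂ)))
    (hadamard_involutive (Fin n → ℂ))
  have hρ := measurable_gaussian_density (n := n)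
  rw [gaussian, prod_withDensity hρ hρ]
  refine measurePreserving_withDensity hvol
    ((hρ.comp measurable_fst).mul (hρ.comp measurable_snd)) fun p => ?_
  have habsSq : absSq (hadamard _ p).1 + absSq (hadamard _ p).2 = absSq p.1 + absSq p.2 := by
    rw [hadamard_apply, absSq_real_smul, absSq_real_smul, ← mul_add,
      add_comm (absSq (p.1 + p.2)), absSq_sub_add_absSq_add, inv_pow, Real.sq_sqrt zero_le_two]
    ring
  rw [← ENNReal.ofReal_mul (by positivity), ← ENNReal.ofReal_mul (by positivity)]
  simp only [mul_mul_mul_comm _ (Real.exp _), ← Real.exp_add, ← neg_add, habsSq]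

lemma integral_gaussian_entire {E : Type*} [NormedAddCommGroup E] [NormedSpace ℂ E]
    [CompleteSpace E] {F : (Fin n → ℂ) → E} (hF : Differentiable ℂ F)
    (hgrowth : GrowthLT 1 F) : ∫ w, F w ∂(gaussian n) = F 0 := by
  have hrot (θ : ℝ) : ∫ w, F (circleMap 0 1 θ • w) ∂(gaussian n) = ∫ w, F w ∂(gaussian n) := by
    have hmp := measurePreserving_smul_gaussian (n := n) (c := circleMap 0 1 θ) (by simp)
    rw [← integral_map (φ := fun w => circleMap 0 1 θ • w) hmp.measurable.aemeasurable
      hF.continuous.aestronglyMeasurable, hmp.map_eq]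
  have hmean (w : Fin n → ℂ) :
      ∫ θ in (0 : ℝ)..2 * Real.pi, F (circleMap 0 1 θ • w) = (2 * Real.pi) • F 0 := by
    have hline : Differentiable ℂ fun t : ℂ => F (t • w) := by fun_prop
    have havg := (hline.diffContOnCl (s := Metric.ball 0 |1|)).circleAverage
    rw [Real.circleAverage_def] at havg
    simp only [zero_smul] at havg
    rw [← havg, smul_inv_smul₀ (by positivity)]
  have hint : Integrable (Function.uncurry fun (θ : ℝ) (w : Fin n → ℂ) => F (circleMap 0 1 θ • w))
      ((volume.restrict (Set.uIoc 0 (2 * Real.pi))).prod (gaussian n)) := by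
    obtain ⟨c, hc, hO⟩ := hgrowth
    obtain ⟨C, hC⟩ := Asymptotics.isBigO_top.1 hO
    have hone : Integrable (fun _ : ℝ => (1 : ℝ))
        (volume.restrict (Set.uIoc 0 (2 * Real.pi))) := intervalIntegrable_const.def'
    have hcont : Continuous F := hF.continuous
    refine (hone.mul_prod ((integrable_exp_mul_absSq (n := n) hc).norm.const_mul C)).mono'
      (by fun_prop) (.of_forall fun p => ?_)
    simpa [Function.uncurry_def, absSq] using hC (circleMap 0 1 p.1 • p.2)
  have hswap := intervalIntegral_integral_swap hint
  simp_rw [hrot, hmean] at hswap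
  simp only [intervalIntegral.integral_const, sub_zero, integral_const, probReal_univ,
    one_smul] at hswap
  exact smul_right_injective E (by positivity : (2 * Real.pi) ≠ 0) hswap

lemma integral_mul_cexp_herm {F : (Fin n → ℂ) → ℂ} (hF : Differentiable ℂ F)
    (hgrowth : GrowthLT 1 F) (z : Fin n → ℂ) :
    ∫ w, F w * Complex.exp (herm z w) ∂(gaussian n) = F z := by
  have hdiff : Differentiable ℂ fun v : Fin n → ℂ => F (z + v) * Complex.exp (-herm v z) := by
    unfold herm; fun_prop
  have hmean := integral_gaussian_entire hdiff <|
    (hgrowth.comp_add_left z).mul_of_forall_pos fun δ hδ =>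
      growthLT_cexp z (fun w => by simpa using norm_herm_le w z) hδ
  simp only [add_zero, herm_zero_left, neg_zero, Complex.exp_zero, mul_one] at hmean
  rw [integral_gaussian_translate _ z, ← hmean]
  congr with v
  rw [mul_assoc, ← Complex.exp_add, herm_add_right]
  ring_nf

end Gaussian

section MultiPow

lemma multiPow_rel {R : ((Fin n → ℂ) → ℂ) → ((Fin n → ℂ) → ℂ) → Prop}
    {A B : Fin n → ((Fin n → ℂ) → ℂ) → ((Fin n → ℂ) → ℂ)}
    (hAB : ∀ k u v, R u v → R (A k u) (B k v)) (i : Fin n → ℕ) {u v : (Fin n → ℂ) → ℂ}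
    (huv : R u v) : R (multiPow A i u) (multiPow B i v) := by
  have hiter (k : Fin n) (m : ℕ) {u v} (h : R u v) : R ((A k)^[m] u) ((B k)^[m] v) := by
    induction m with
    | zero => exact h
    | succ m ih =>
      rw [Function.iterate_succ_apply', Function.iterate_succ_apply']
      exact hAB k _ _ ih
  unfold multiPow
  induction List.finRange n with
  | nil => exact huv
  | cons k l ih => exact hiter k (i k) ih

lemma multiPow_mul (a : Fin n → (Fin n → ℂ) → ℂ) (i : Fin n → ℕ) (φ : (Fin n → ℂ) → ℂ) :
    multiPow (fun k u w => u w * a k w) i φ = fun w => φ w * ∏ k, a k w ^ i k := by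
  have hiter (k : Fin n) (m : ℕ) (u : (Fin n → ℂ) → ℂ) :
      (fun u w => u w * a k w)^[m] u = fun w => u w * a k w ^ m := by
    induction m with
    | zero => simp
    | succ m ih =>
      rw [Function.iterate_succ_apply', ih]
      funext w
      ring
  simp_rw [multiPow, Fin.prod_univ_def]
  induction List.finRange n with
  | nil => simp
  | cons k l ih =>
    rw [List.foldr_cons, ih, hiter]
    funext w
    rw [List.map_cons, List.prod_cons]
    ring

end MultiPow

section FockProjection

variable {E : Type*} [NormedAddCommGroup E] [NormedSpace ℂ E]

/-- The complex linear form `z ↦ z · w̄`. -/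
noncomputable def hermForm (w : Fin n → ℂ) : (Fin n → ℂ) →L[ℂ] ℂ :=
  (dotProductBilin ℂ ℂ).toContinuousBilinearMap (star w)

lemma hermForm_apply (w z : Fin n → ℂ) : hermForm w z = herm z w := by
  exact dotProduct_comm (star w) z

@[fun_prop]
lemma continuous_hermForm : Continuous (hermForm : (Fin n → ℂ) → (Fin n → ℂ) →L[ℂ] ℂ) := by
  unfold hermForm; fun_prop

lemma growthLT_hermForm {δ : ℝ} (hδ : 0 < δ) :
    GrowthLT δ (hermForm : (Fin n → ℂ) → (Fin n → ℂ) →L[ℂ] ℂ) :=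
  (growthLT_id hδ).of_isBigO <|
    .of_bound ‖(dotProductBilin ℂ ℂ : (Fin n → ℂ) →ₗ[ℂ] _).toContinuousBilinearMap‖ <|
      .of_forall fun w => by
        simpa only [norm_star, hermForm] using ContinuousLinearMap.le_opNorm _ (star w)

/-- The Fock projection `P φ(z) = ∫ φ(w) exp (z · w̄) dμ(w)`: the integral operator which reproduces
entire functions. It is defined for vector-valued `φ` because its derivatives are again of this
form, with values in spaces of linear maps. -/
noncomputable def fockProj (φ : (Fin n → ℂ) → E) (z : Fin n → ℂ) : E :=
  ∫ w, Complex.exp (herm z w) • φ w ∂(gaussian n)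

lemma fockProj_eq_self {F : (Fin n → ℂ) → ℂ} (hF : Differentiable ℂ F) (hgrowth : GrowthLT 1 F) :
    fockProj F = F :=
  funext fun z => by simpa only [fockProj, smul_eq_mul, mul_comm] using
    integral_mul_cexp_herm hF hgrowth z

lemma fockProj_zero (φ : (Fin n → ℂ) → E) : fockProj φ 0 = ∫ w, φ w ∂(gaussian n) := by
  simp [fockProj, herm_zero_left]

lemma GrowthLT.smul_of_forall_pos {c : ℝ} {φ : (Fin n → ℂ) → E} {a : (Fin n → ℂ) → ℂ}
    (hφ : GrowthLT c φ) (ha : ∀ δ > 0, GrowthLT δ a) : GrowthLT c fun w => a w • φ w :=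
  (hφ.norm.mul_of_forall_pos fun δ hδ => (ha δ hδ).norm).of_norm_le fun w => by
    simp [norm_smul, mul_comm]

lemma GrowthLT.smulRight_hermForm {c : ℝ} {φ : (Fin n → ℂ) → E} (hφ : GrowthLT c φ) :
    GrowthLT c fun w => (hermForm w).smulRight (φ w) :=
  (hφ.norm.mul_of_forall_pos fun _ hδ => (growthLT_hermForm hδ).norm).of_norm_le fun w => by
    simp [mul_comm]

lemma aestronglyMeasurable_smulRight_hermForm {φ : (Fin n → ℂ) → E}
    (hm : AEStronglyMeasurable φ (gaussian n)) :
    AEStronglyMeasurable (fun w => (hermForm w).smulRight (φ w)) (gaussian n) :=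
  (ContinuousLinearMap.smulRightL ℂ (Fin n → ℂ) E).aestronglyMeasurable_comp₂
    continuous_hermForm.aestronglyMeasurable hm

lemma norm_cexp_herm_le_of_mem_ball {x z : Fin n → ℂ} {r : ℝ} (hx : x ∈ Metric.ball z r)
    (w : Fin n → ℂ) :
    ‖Complex.exp (herm x w)‖ ≤ Real.exp (∑ k, ‖w k‖ * ‖((‖z k‖ + r : ℝ) : ℂ)‖) := by
  refine (Complex.norm_exp_le_exp_norm _).trans (Real.exp_le_exp.2 ((norm_herm_le x w).trans ?_))
  refine Finset.sum_le_sum fun k _ => ?_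
  rw [mul_comm]
  gcongr
  calc ‖x k‖ ≤ ‖z k‖ + ‖x k - z k‖ := norm_le_norm_add_norm_sub' _ _
    _ ≤ ‖z k‖ + r := by
      gcongr
      exact (norm_le_pi_norm (x - z) k).trans (mem_ball_iff_norm.1 hx).le
    _ ≤ ‖((‖z k‖ + r : ℝ) : ℂ)‖ := by
      rw [Complex.norm_real]
      exact Real.le_norm_self _

lemma integrable_cexp_herm_smul {φ : (Fin n → ℂ) → E} (hm : AEStronglyMeasurable φ (gaussian n))
    (hφ : GrowthLT 1 φ) (z : Fin n → ℂ) :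
    Integrable (fun w => Complex.exp (herm z w) • φ w) (gaussian n) :=
  (hφ.smul_of_forall_pos fun _ => growthLT_cexp_herm_right z).integrable (by fun_prop)

lemma hasFDerivAt_fockProj {φ : (Fin n → ℂ) → E} (hm : AEStronglyMeasurable φ (gaussian n))
    (hφ : GrowthLT 1 φ) (z : Fin n → ℂ) :
    HasFDerivAt (fockProj φ) (fockProj (fun w => (hermForm w).smulRight (φ w)) z) z := by
  have hmψ := aestronglyMeasurable_smulRight_hermForm hm
  have hψ := hφ.smulRight_hermForm
  have hderiv (x w : Fin n → ℂ) : HasFDerivAt (fun x => Complex.exp (herm x w) • φ w)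
      (Complex.exp (herm x w) • (hermForm w).smulRight (φ w)) x := by
    have hform : HasFDerivAt (fun x => herm x w) (hermForm w) x := by
      simpa only [← hermForm_apply] using (hermForm w).hasFDerivAt
    exact (hform.cexp.smul_const (φ w)).congr_fderiv (by ext; simp [mul_smul])
  refine hasFDerivAt_integral_of_dominated_of_fderiv_le (Metric.ball_mem_nhds z one_pos)
    (F' := fun x w => Complex.exp (herm x w) • (hermForm w).smulRight (φ w))
    (bound := fun w => Real.exp (∑ k, ‖w k‖ * ‖((‖z k‖ + 1 : ℝ) : ℂ)‖)
      * ‖(hermForm w).smulRight (φ w)‖)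
    (.of_forall fun x => (integrable_cexp_herm_smul hm hφ x).aestronglyMeasurable)
    (integrable_cexp_herm_smul hm hφ z)
    (integrable_cexp_herm_smul hmψ hψ z).aestronglyMeasurable (.of_forall fun w x hx => ?_) ?_
    (.of_forall fun w x _ => hderiv x w)
  · rw [norm_smul]
    gcongr
    exact norm_cexp_herm_le_of_mem_ball hx w
  · simp only [mul_comm (Real.exp _)]
    exact (hψ.norm.mul_of_forall_pos fun _ => growthLT_exp_sum_norm_mul_norm _).integrable <|
      hmψ.norm.mul (Continuous.aestronglyMeasurable (by fun_prop))

lemma contDiff_fockProj {φ : (Fin n → ℂ) → E} (hm : AEStronglyMeasurable φ (gaussian n))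
    (hφ : GrowthLT 1 φ) : ContDiff ℂ ∞ (fockProj φ) := by
  refine contDiff_infty.2 fun m => ?_
  induction m generalizing E with
  | zero =>
    exact contDiff_zero.2 (continuous_iff_continuousAt.2 fun z =>
      (hasFDerivAt_fockProj hm hφ z).continuousAt)
  | succ m ih =>
    exact contDiff_succ_iff_hasFDerivAt.2 ⟨_,
      ih (aestronglyMeasurable_smulRight_hermForm hm) hφ.smulRight_hermForm,
      hasFDerivAt_fockProj hm hφ⟩

lemma contDiff_of_growthLT {F : (Fin n → ℂ) → ℂ} (hF : Differentiable ℂ F)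
    (hgrowth : GrowthLT 1 F) : ContDiff ℂ ∞ F := by
  simpa only [fockProj_eq_self hF hgrowth] using
    contDiff_fockProj hF.continuous.aestronglyMeasurable hgrowth

end FockProjection

section Wirtinger

lemma dz_of_hasFDerivAt {h : (Fin n → ℂ) → ℂ} {D : (Fin n → ℂ) →L[ℂ] ℂ} {z : Fin n → ℂ}
    (hD : HasFDerivAt h D z) (k : Fin n) : dz k h z = D (Pi.single k 1) := by
  have hI : (Pi.single k Complex.I : Fin n → ℂ) = Complex.I • Pi.single k 1 := by
    rw [← Pi.single_smul]; simp
  rw [dz, (hD.restrictScalars ℝ).fderiv]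
  simp only [ContinuousLinearMap.coe_restrictScalars', hI, map_smul, smul_eq_mul]
  rw [← mul_assoc, Complex.I_mul_I]; ring

lemma dz_fockProj {φ : (Fin n → ℂ) → ℂ} (hm : AEStronglyMeasurable φ (gaussian n))
    (hφ : GrowthLT 1 φ) (k : Fin n) :
    dz k (fockProj φ) = fockProj fun w => φ w * conj (w k) := by
  funext z
  rw [dz_of_hasFDerivAt (hasFDerivAt_fockProj hm hφ z) k, fockProj,
    ContinuousLinearMap.integral_apply (integrable_cexp_herm_smul
      (aestronglyMeasurable_smulRight_hermForm hm) hφ.smulRight_hermForm z)]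
  simp [fockProj, hermForm_apply, herm, Pi.single_apply, mul_comm]

lemma multiPow_dz_fockProj {φ : (Fin n → ℂ) → ℂ} (hm : AEStronglyMeasurable φ (gaussian n))
    (hφ : GrowthLT 1 φ) (i : Fin n → ℕ) :
    multiPow dz i (fockProj φ) = fockProj fun w => φ w * ∏ k, conj (w k) ^ i k := by
  have hcoord (k : Fin n) : ∀ δ > 0, GrowthLT δ fun w : Fin n → ℂ => conj (w k) := fun δ hδ =>
    (growthLT_id hδ).of_norm_le fun w => by simpa using norm_le_pi_norm w k
  rw [← multiPow_mul]
  refine (multiPow_rel (A := dz) (B := fun k v w => v w * conj (w k))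
    (R := fun u v => u = fockProj v ∧ AEStronglyMeasurable v (gaussian n) ∧ GrowthLT 1 v)
    ?_ i ⟨rfl, hm, hφ⟩).1
  rintro k _ v ⟨rfl, hm, hv⟩
  exact ⟨dz_fockProj hm hv k, hm.mul (Continuous.aestronglyMeasurable (by fun_prop)),
    hv.mul_of_forall_pos (hcoord k)⟩

lemma dz_conjStar (k : Fin n) (h : (Fin n → ℂ) → ℂ) : dz k (conjStar h) = conjStar (dz k h) := by
  let e : (Fin n → ℂ) ≃L[ℝ] (Fin n → ℂ) := .piCongrRight fun _ => Complex.conjCLE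
  have hconj (j : Fin n) (a : ℂ) : e (Pi.single j a) = Pi.single j (conj a) := by
    funext l
    exact Pi.apply_single (fun _ : Fin n => (conj : ℂ → ℂ)) (fun _ => map_zero conj) j a l
  have hfderiv (z v : Fin n → ℂ) :
      fderiv ℝ (conjStar h) z v = conj (fderiv ℝ h (e z) (e v)) := by
    change fderiv ℝ (Complex.conjCLE ∘ (h ∘ e)) z v = _
    rw [ContinuousLinearEquiv.comp_fderiv, e.comp_right_fderiv]
    rfl
  funext z
  have hdz : conjStar (dz k h) z = conj (dz k h (e z)) := rfl
  rw [hdz, dz, dz, hfderiv, hfderiv, hconj, hconj]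
  simp [Pi.single_neg, Complex.conj_ofNat]

lemma taylorCoeff_conjStar (h : (Fin n → ℂ) → ℂ) (i : Fin n → ℕ) :
    taylorCoeff (conjStar h) i = conj (taylorCoeff h i) := by
  have hpow : multiPow dz i (conjStar h) = conjStar (multiPow dz i h) :=
    multiPow_rel (R := fun u v => u = conjStar v) (by rintro k _ v rfl; exact dz_conjStar k v) i rfl
  simp [taylorCoeff, hpow, conjStar, Pi.zero_def]

end Wirtinger

section Freezing

lemma dz_comp_prodMk_star {Φ : (Fin n → ℂ) × (Fin n → ℂ) → ℂ} (hΦ : Differentiable ℂ Φ)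
    (k : Fin n) (z : Fin n → ℂ) :
    dz k (fun z => Φ (z, star z)) z = fderiv ℂ Φ (z, star z) (Pi.single k 1, 0) := by
  have hpair : HasFDerivAt (fun z : Fin n → ℂ => (z, star z))
      ((ContinuousLinearMap.id ℝ _).prod (starL' ℝ : (Fin n → ℂ) ≃L[ℝ] _).toContinuousLinearMap)
      z :=
    (hasFDerivAt_id z).prodMk (starL' ℝ : (Fin n → ℂ) ≃L[ℝ] _).hasFDerivAt
  have hderiv := ((hΦ (z, star z)).hasFDerivAt.restrictScalars ℝ).comp z hpair
  have hvec (a : ℂ) : ((Pi.single k a, star (Pi.single k a)) : (Fin n → ℂ) × (Fin n → ℂ))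
      = a • (Pi.single k 1, 0) + conj a • (0, Pi.single k 1) := by
    ext j <;> rcases eq_or_ne j k with rfl | h <;> simp [*]
  have hD (a : ℂ) : fderiv ℝ (fun z => Φ (z, star z)) z (Pi.single k a)
      = a * fderiv ℂ Φ (z, star z) (Pi.single k 1, 0)
        + conj a * fderiv ℂ Φ (z, star z) (0, Pi.single k 1) := by
    rw [← smul_eq_mul, ← smul_eq_mul, ← map_smul, ← map_smul, ← map_add, ← hvec]
    exact DFunLike.congr_fun hderiv.fderiv _
  rw [dz, hD, hD, Complex.conj_I, map_one]
  linear_combination (-(fderiv ℂ Φ (z, star z) (Pi.single k 1, 0)) / 2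
    + fderiv ℂ Φ (z, star z) (0, Pi.single k 1) / 2) * Complex.I_mul_I

lemma dz_comp_sub_mul_cexp_herm {f : (Fin n → ℂ) → ℂ} (hf : Differentiable ℂ f)
    (ζ : Fin n → ℂ) (k : Fin n) (x : Fin n → ℂ) :
    dz k (fun x => f (ζ - x) * Complex.exp (herm x ζ)) x
      = (conj (ζ k) * f (ζ - x) - fderiv ℂ f (ζ - x) (Pi.single k 1))
        * Complex.exp (herm x ζ) := by
  have hshift : HasFDerivAt (fun x => f (ζ - x)) (-fderiv ℂ f (ζ - x)) x := by
    simpa [Function.comp_def] using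
      (hf (ζ - x)).hasFDerivAt.comp x ((hasFDerivAt_id x).const_sub ζ)
  have hexp : HasFDerivAt (fun x => Complex.exp (herm x ζ))
      (Complex.exp (herm x ζ) • hermForm ζ) x := by
    simpa only [← hermForm_apply] using (hermForm ζ).hasFDerivAt.cexp
  rw [dz_of_hasFDerivAt (hshift.fun_mul hexp) k]
  simp only [add_apply, smul_apply, neg_apply, smul_eq_mul, hermForm_apply, herm, Pi.single_apply,
    ite_mul, one_mul, zero_mul, Finset.sum_ite_eq', Finset.mem_univ, ↓reduceIte]
  ring

lemma multiPow_conjSubDz {f : (Fin n → ℂ) → ℂ} (hf : ContDiff ℂ ∞ f) (i : Fin n → ℕ)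
    (ζ : Fin n → ℂ) :
    multiPow conjSubDz i f ζ
      = multiPow dz i (fun x => f (ζ - x) * Complex.exp (herm x ζ)) 0 := by
  -- Iterated applications of `z̄ₖ - ∂ₖ` to `f` have the form `Φ(z, z̄)` with `Φ` holomorphic.
  -- Freezing `z̄` at `ζ̄` turns `z̄ₖ - ∂ₖ` into `∂ₖ` acting on `Φ(ζ - x, ζ̄) e^{x·ζ̄}`.
  let R (u v : (Fin n → ℂ) → ℂ) : Prop := ∃ Φ : (Fin n → ℂ) × (Fin n → ℂ) → ℂ, ContDiff ℂ ∞ Φ ∧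
    (u = fun z => Φ (z, star z)) ∧ v = fun x => Φ (ζ - x, star ζ) * Complex.exp (herm x ζ)
  have hR (k u v) (huv : R u v) : R (conjSubDz k u) (dz k v) := by
    obtain ⟨Φ, hΦ, rfl, rfl⟩ := huv
    have hΦ' : Differentiable ℂ Φ := hΦ.differentiable (by simp)
    refine ⟨fun p => p.2 k * Φ p - fderiv ℂ Φ p (Pi.single k 1, 0), ?_, funext fun z => ?_,
      funext fun x => ?_⟩
    · have := hΦ.fderiv_right (m := ∞) (by simp)
      fun_prop
    · rw [conjSubDz, dz_comp_prodMk_star hΦ']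
      rfl
    · rw [dz_comp_sub_mul_cexp_herm (f := fun z => Φ (z, star ζ)) (by fun_prop)]
      have hpartial : fderiv ℂ (fun z => Φ (z, star ζ)) (ζ - x)
          = fderiv ℂ Φ (ζ - x, star ζ) ∘L .inl ℂ (Fin n → ℂ) (Fin n → ℂ) :=
        ((hΦ' _).hasFDerivAt.comp _ (hasFDerivAt_prodMk_left _ _)).fderiv
      rw [hpartial]
      rfl
  obtain ⟨Φ, -, hu, hv⟩ := multiPow_rel hR i (u := f)
    ⟨fun p => f p.1, hf.comp contDiff_fst, rfl, rfl⟩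
  simp [hu, hv, herm_zero_left]

end Freezing

section ExpSeries

lemma hasSum_fin_prod {ι R : Type*} [NormedCommRing R] [CompleteSpace R] {f : Fin n → ι → R}
    {s : Fin n → R} (h : ∀ k, HasSum (f k) (s k)) (hnorm : ∀ k, Summable fun j => ‖f k j‖) :
    HasSum (fun i : Fin n → ι => ∏ k, f k (i k)) (∏ k, s k) ∧
      Summable fun i : Fin n → ι => ‖∏ k, f k (i k)‖ := by
  induction n with
  | zero => exact ⟨by simp, .of_finite⟩
  | succ n ih =>
    obtain ⟨htail, htail_norm⟩ := ih (fun k => h k.succ) fun k => hnorm k.succ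
    have hcons (p : ι × (Fin n → ι)) :
        ∏ k, f k (Fin.consEquiv (fun _ => ι) p k) = f 0 p.1 * ∏ k : Fin n, f k.succ (p.2 k) := by
      simp [Fin.prod_univ_succ, Fin.consEquiv]
    rw [← (Fin.consEquiv fun _ => ι).hasSum_iff, ← (Fin.consEquiv fun _ => ι).summable_iff,
      Fin.prod_univ_succ]
    simp only [Function.comp_def, hcons]
    have hmul := (hnorm 0).mul_norm htail_norm
    have hsum := (h 0).mul htail hmul.of_norm
    exact ⟨hsum, hmul⟩

lemma hasSum_prod_pow_div_factorial {𝕜 : Type*} [NormedField 𝕜] [NormedAlgebra ℚ 𝕜]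
    [CompleteSpace 𝕜] (y : Fin n → 𝕜) :
    HasSum (fun i : Fin n → ℕ => ∏ k, y k ^ i k / ((i k).factorial : 𝕜))
      (NormedSpace.exp (∑ k, y k)) := by
  have hsum (k : Fin n) := NormedSpace.expSeries_div_hasSum_exp (y k)
  have hnorm (k : Fin n) := NormedSpace.norm_expSeries_div_summable (y k)
  rw [NormedSpace.exp_sum]
  exact (hasSum_fin_prod hsum hnorm).1

lemma hasSum_integral_mul_exp_sum {α : Type*} [MeasurableSpace α] {ν : Measure α} {φ : α → ℂ}
    {y : α → Fin n → ℂ} (hφ : AEStronglyMeasurable φ ν) (hy : AEStronglyMeasurable y ν)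
    (hint : Integrable (fun a => ‖φ a‖ * Real.exp (∑ k, ‖y a k‖)) ν) :
    HasSum (fun i : Fin n → ℕ => ∫ a, φ a * ∏ k, y a k ^ i k / ((i k).factorial : ℂ) ∂ν)
      (∫ a, φ a * Complex.exp (∑ k, y a k) ∂ν) := by
  have hbound (a : α) : HasSum (fun i : Fin n → ℕ => ‖φ a‖ * ∏ k, ‖y a k‖ ^ i k / (i k).factorial)
      (‖φ a‖ * Real.exp (∑ k, ‖y a k‖)) := by
    rw [Real.exp_eq_exp_ℝ]
    exact (hasSum_prod_pow_div_factorial fun k => ‖y a k‖).mul_left _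
  refine hasSum_integral_of_dominated_convergence
    (fun i a => ‖φ a‖ * ∏ k, ‖y a k‖ ^ i k / (i k).factorial) (fun i => ?_)
    (fun i => .of_forall fun a => ?_) (.of_forall fun a => (hbound a).summable)
    (hint.congr (.of_forall fun a => (hbound a).tsum_eq.symm)) (.of_forall fun a => ?_)
  · exact hφ.mul (Continuous.comp_aestronglyMeasurable
      (g := fun z : Fin n → ℂ => ∏ k, z k ^ i k / ((i k).factorial : ℂ)) (by fun_prop) hy)
  · simp
  · rw [Complex.exp_eq_exp_ℂ]
    exact (hasSum_prod_pow_div_factorial (y a)).mul_left _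

end ExpSeries

section Pairing

variable {φ ψ : (Fin n → ℂ) → ℂ}

lemma integrable_mul_mul_exp_sum_norm_mul_norm (hm : AEStronglyMeasurable φ (gaussian n))
    (hφ : GrowthLT (1 / 2) φ) (hm' : AEStronglyMeasurable ψ (gaussian n))
    (hψ : GrowthLT (1 / 2) ψ) :
    Integrable (fun p : (Fin n → ℂ) × (Fin n → ℂ) =>
        ‖φ p.1‖ * ‖ψ p.2‖ * Real.exp (∑ k, ‖p.2 k‖ * ‖p.1 k‖))
      ((gaussian n).prod (gaussian n)) := by
  have hexp {χ : (Fin n → ℂ) → ℂ} (hm : AEStronglyMeasurable χ (gaussian n))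
      (hχ : GrowthLT (1 / 2) χ) :
      Integrable (fun w => ‖χ w‖ * Real.exp (1 / 2 * absSq w)) (gaussian n) := by
    obtain ⟨c, hc, hχ⟩ := hχ.exists_lt
    refine GrowthLT.integrable ?_ (hm.norm.mul (Continuous.aestronglyMeasurable (by fun_prop)))
    simpa using hχ.norm.mul (growthLT_exp_mul_absSq (c' := 1 / 2) (c := 1 - c) (by linarith))
  refine ((hexp hm hφ).mul_prod (hexp hm' hψ)).mono' ((hm.norm.comp_fst.mul hm'.norm.comp_snd).mul
    (Continuous.aestronglyMeasurable (by fun_prop))) (.of_forall fun p => ?_)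
  rw [Real.norm_of_nonneg (by positivity), mul_mul_mul_comm, ← Real.exp_add]
  gcongr
  have := sum_norm_mul_norm_le (by norm_num : (0 : ℝ) < 1 / 2) p.2 p.1
  norm_num at this ⊢
  linarith

lemma integrable_mul_conj_mul_cexp_herm (hm : AEStronglyMeasurable φ (gaussian n))
    (hφ : GrowthLT (1 / 2) φ) (hm' : AEStronglyMeasurable ψ (gaussian n))
    (hψ : GrowthLT (1 / 2) ψ) :
    Integrable (fun p : (Fin n → ℂ) × (Fin n → ℂ) =>
        φ p.1 * conj (ψ p.2) * Complex.exp (herm p.2 p.1))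
      ((gaussian n).prod (gaussian n)) := by
  refine (integrable_mul_mul_exp_sum_norm_mul_norm hm hφ hm' hψ).mono'
    ((hm.comp_fst.mul (Complex.continuous_conj.comp_aestronglyMeasurable hm'.comp_snd)).mul
      (Continuous.aestronglyMeasurable (by fun_prop))) (.of_forall fun p => ?_)
  rw [norm_mul, norm_mul, Complex.norm_conj]
  gcongr
  exact (Complex.norm_exp_le_exp_norm _).trans (Real.exp_le_exp.2 (norm_herm_le _ _))

lemma integral_mul_conj_mul_cexp_herm (hm : AEStronglyMeasurable φ (gaussian n))
    (hφ : GrowthLT (1 / 2) φ) (hm' : AEStronglyMeasurable ψ (gaussian n))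
    (hψ : GrowthLT (1 / 2) ψ) :
    ∫ p : (Fin n → ℂ) × (Fin n → ℂ), φ p.1 * conj (ψ p.2) * Complex.exp (herm p.2 p.1)
        ∂(gaussian n).prod (gaussian n)
      = ∫ v, fockProj φ v * conj (ψ v) ∂(gaussian n) := by
  rw [integral_prod_symm _ (integrable_mul_conj_mul_cexp_herm hm hφ hm' hψ)]
  simp only [fockProj, smul_eq_mul, ← integral_mul_const]
  congr! 4
  ring

lemma integral_fockProj_mul_conj (hm : AEStronglyMeasurable φ (gaussian n))
    (hφ : GrowthLT (1 / 2) φ) (hm' : AEStronglyMeasurable ψ (gaussian n))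
    (hψ : GrowthLT (1 / 2) ψ) :
    ∫ v, fockProj φ v * conj (ψ v) ∂(gaussian n)
      = ∫ x, φ x * conj (fockProj ψ x) ∂(gaussian n) := by
  rw [← integral_mul_conj_mul_cexp_herm hm hφ hm' hψ,
    integral_prod _ (integrable_mul_conj_mul_cexp_herm hm hφ hm' hψ)]
  simp only [fockProj, smul_eq_mul, ← integral_conj, ← integral_const_mul, map_mul,
    ← Complex.exp_conj, conj_herm]
  congr! 4
  ring

lemma hasSum_fockProj_pairing (hm : AEStronglyMeasurable φ (gaussian n))
    (hφ : GrowthLT (1 / 2) φ) (hm' : AEStronglyMeasurable ψ (gaussian n))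
    (hψ : GrowthLT (1 / 2) ψ) :
    HasSum (fun i : Fin n → ℕ =>
        (∫ x, φ x * ∏ k, conj (x k) ^ i k ∂(gaussian n))
          * conj (∫ v, ψ v * ∏ k, conj (v k) ^ i k ∂(gaussian n))
          / ((∏ k, (i k).factorial : ℕ) : ℂ))
      (∫ v, fockProj φ v * conj (ψ v) ∂(gaussian n)) := by
  rw [← integral_mul_conj_mul_cexp_herm hm hφ hm' hψ]
  have hsum := hasSum_integral_mul_exp_sum
    (φ := fun p : (Fin n → ℂ) × (Fin n → ℂ) => φ p.1 * conj (ψ p.2))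
    (y := fun p k => p.2 k * conj (p.1 k))
    (hm.comp_fst.mul (Complex.continuous_conj.comp_aestronglyMeasurable hm'.comp_snd))
    (Continuous.aestronglyMeasurable (by fun_prop))
    (by simpa using integrable_mul_mul_exp_sum_norm_mul_norm hm hφ hm' hψ)
  refine hsum.congr_fun fun i => ?_
  rw [← integral_conj, ← integral_prod_mul, ← integral_div]
  congr with p
  simp only [map_mul, map_prod, map_pow, Complex.conj_conj, mul_pow, Finset.prod_div_distrib,
    Finset.prod_mul_distrib, Nat.cast_prod]
  ring

end Pairing

section BerezinInv

/-- The symmetric integral formula `∫ f(ζ - x) conj (g(ζ + x)) dμ(x)` for `g*(ζ̄ - ∂_ζ) f(ζ)`. -/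
noncomputable def berezinInv (f g : (Fin n → ℂ) → ℂ) (ζ : Fin n → ℂ) : ℂ :=
  ∫ x, f (ζ - x) * conj (g (ζ + x)) ∂(gaussian n)

variable {f g : (Fin n → ℂ) → ℂ}

lemma fockProj_mul_cexp_herm (hg : Differentiable ℂ g) (hgrowth : GrowthLT 1 g)
    (ζ : Fin n → ℂ) :
    fockProj (fun w => g w * Complex.exp (herm ζ w)) = fun x => g (ζ + x) := by
  funext x
  rw [← congrFun (fockProj_eq_self hg hgrowth) (ζ + x)]
  simp only [fockProj, smul_eq_mul, herm_add_left, Complex.exp_add]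
  congr with w
  ring

lemma integral_mul_cexp_herm_mul_conj (hf : Differentiable ℂ f) (hfgrowth : GrowthLT (1 / 2) f)
    (hg : Differentiable ℂ g) (hggrowth : GrowthLT (1 / 2) g) (ζ : Fin n → ℂ) :
    ∫ x, f (ζ - x) * Complex.exp (herm x ζ) * conj (g x) ∂(gaussian n) = berezinInv f g ζ := by
  have hshift : Differentiable ℂ fun x => f (ζ - x) := by fun_prop
  have hshift_growth := hfgrowth.comp_sub_left ζ
  have hadj := integral_fockProj_mul_conj (ψ := fun w => g w * Complex.exp (herm ζ w))
    hshift.continuous.aestronglyMeasurable hshift_growth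
    (hg.continuous.aestronglyMeasurable.mul (Continuous.aestronglyMeasurable (by fun_prop)))
    (hggrowth.mul_of_forall_pos fun _ => growthLT_cexp_herm_right ζ)
  rw [fockProj_eq_self hshift (hshift_growth.mono (by norm_num)),
    fockProj_mul_cexp_herm hg (hggrowth.mono (by norm_num))] at hadj
  rw [berezinInv, ← hadj]
  congr with x
  rw [map_mul, ← Complex.exp_conj, conj_herm]
  ring

lemma hasSum_opTerm (hf : Differentiable ℂ f) (hfgrowth : GrowthLT (1 / 2) f)
    (hg : Differentiable ℂ g) (hggrowth : GrowthLT (1 / 2) g) (ζ : Fin n → ℂ) :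
    HasSum (opTerm (conjStar g) f ζ) (berezinInv f g ζ) := by
  let H (x : Fin n → ℂ) : ℂ := f (ζ - x) * Complex.exp (herm x ζ)
  have hH : Differentiable ℂ H := by unfold H herm; fun_prop
  have hHgrowth : GrowthLT (1 / 2) H :=
    (hfgrowth.comp_sub_left ζ).mul_of_forall_pos fun _ => growthLT_cexp_herm_left ζ
  have hmoment {F : (Fin n → ℂ) → ℂ} (hF : Differentiable ℂ F) (hFgrowth : GrowthLT (1 / 2) F)
      (i : Fin n → ℕ) :
      multiPow dz i F 0 = ∫ w, F w * ∏ k, conj (w k) ^ i k ∂(gaussian n) := by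
    have hF1 := hFgrowth.mono (by norm_num : (1 / 2 : ℝ) ≤ 1)
    rw [← fockProj_zero, ← multiPow_dz_fockProj hF.continuous.aestronglyMeasurable hF1,
      fockProj_eq_self hF hF1]
  have hsmooth := contDiff_of_growthLT hf (hfgrowth.mono (by norm_num))
  have hsum := hasSum_fockProj_pairing hH.continuous.aestronglyMeasurable hHgrowth
    hg.continuous.aestronglyMeasurable hggrowth
  rw [fockProj_eq_self hH (hHgrowth.mono (by norm_num)),
    integral_mul_cexp_herm_mul_conj hf hfgrowth hg hggrowth] at hsum
  refine hsum.congr_fun fun i => ?_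
  rw [opTerm, taylorCoeff_conjStar, taylorCoeff, multiPow_conjSubDz hsmooth, hmoment hg hggrowth,
    hmoment hH hHgrowth, map_div₀, Complex.conj_natCast]
  ring

end BerezinInv

section Berezin

lemma normKernel_mul_conj (w z : Fin n → ℂ) :
    normKernel w z * conj (normKernel w z)
      = Complex.exp (herm w z + herm z w) * Complex.exp (-herm z z) := by
  have hre : (kernel z z).re = Real.exp (absSq z) := by
    rw [kernel, herm_self, ← Complex.ofReal_exp, Complex.ofReal_re]
  have hsqrt : (√(Real.exp (absSq z)) : ℂ) * √(Real.exp (absSq z)) = Complex.exp (herm z z) := by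
    rw [← Complex.ofReal_mul, Real.mul_self_sqrt (Real.exp_pos _).le, herm_self,
      Complex.ofReal_exp]
  rw [normKernel, hre, map_div₀, Complex.conj_ofReal, div_mul_div_comm, hsqrt, kernel,
    ← Complex.exp_conj, conj_herm, ← Complex.exp_add, ← Complex.exp_sub, ← Complex.exp_add,
    sub_eq_add_neg]

lemma berezin_eq_integral_mul_exp (u : (Fin n → ℂ) → ℂ) (z : Fin n → ℂ) :
    berezin u z = Complex.exp (-herm z z)
      * ∫ w, u w * Complex.exp (herm w z + herm z w) ∂(gaussian n) := by
  rw [berezin, ← integral_const_mul]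
  congr with w
  rw [mul_assoc, normKernel_mul_conj]
  ring

lemma berezin_eq_integral_translate (u : (Fin n → ℂ) → ℂ) (z : Fin n → ℂ) :
    berezin u z = ∫ v, u (z + v) ∂(gaussian n) := by
  rw [berezin_eq_integral_mul_exp, integral_gaussian_translate _ z, ← integral_const_mul]
  congr with v
  have hcancel : Complex.exp (-herm z z) * Complex.exp (herm (z + v) z + herm z (z + v))
      * Complex.exp (-herm v z - herm z v - herm z z) = 1 := by
    rw [← Complex.exp_add, ← Complex.exp_add, herm_add_left, herm_add_right]
    convert Complex.exp_zero using 2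
    ring
  linear_combination u (z + v) * hcancel

variable {f g : (Fin n → ℂ) → ℂ}

lemma GrowthLT.berezinInv {c : ℝ} (hc : 2 * c ≤ 1) (hf : GrowthLT c f) (hg : GrowthLT c g) :
    GrowthLT (2 * c) (berezinInv f g) := by
  obtain ⟨cf, hcf, hf⟩ := hf
  obtain ⟨cg, hcg, hg⟩ := hg
  obtain ⟨Cf, hCf⟩ := Asymptotics.isBigO_top.1 hf
  obtain ⟨Cg, hCg⟩ := Asymptotics.isBigO_top.1 hg
  have hd : max cf cg < c := max_lt hcf hcg
  generalize hd_def : max cf cg = d at hd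
  have hbound (ζ x : Fin n → ℂ) : ‖f (ζ - x) * conj (g (ζ + x))‖
      ≤ |Cf| * |Cg| * Real.exp (2 * d * absSq ζ) * Real.exp (2 * d * absSq x) := by
    have hle {e C : ℝ} (he : e ≤ d) (w : Fin n → ℂ) :
        C * ‖Real.exp (e * absSq w)‖ ≤ |C| * Real.exp (d * absSq w) := by
      rw [Real.norm_of_nonneg (Real.exp_pos _).le]
      have := absSq_nonneg w
      gcongr
      exact le_abs_self C
    calc ‖f (ζ - x) * conj (g (ζ + x))‖
        ≤ |Cf| * Real.exp (d * absSq (ζ - x)) * (|Cg| * Real.exp (d * absSq (ζ + x))) := by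
          rw [norm_mul, Complex.norm_conj]
          gcongr
          · exact (hCf _).trans (hle (hd_def ▸ le_max_left _ _) _)
          · exact (hCg _).trans (hle (hd_def ▸ le_max_right _ _) _)
      _ = |Cf| * |Cg| * Real.exp (d * (absSq (ζ - x) + absSq (ζ + x))) := by
          rw [mul_mul_mul_comm, ← Real.exp_add, mul_add]
      _ = |Cf| * |Cg| * Real.exp (2 * d * absSq ζ) * Real.exp (2 * d * absSq x) := by
          rw [absSq_sub_add_absSq_add, mul_assoc (_ * _), ← Real.exp_add]
          ring_nf
  refine ⟨2 * d, by linarith, .of_bound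
    (|Cf| * |Cg| * ∫ x : Fin n → ℂ, Real.exp (2 * d * absSq x) ∂(gaussian n)) <|
    .of_forall fun ζ => ?_⟩
  refine (norm_integral_le_of_norm_le
    ((integrable_exp_mul_absSq (by linarith)).const_mul _) (.of_forall (hbound ζ))).trans_eq ?_
  rw [integral_const_mul, Real.norm_of_nonneg (Real.exp_pos _).le]
  ring

lemma memLp_berezinInv (hf : Continuous f) (hfgrowth : GrowthLT (1 / 4) f)
    (hg : Continuous g) (hggrowth : GrowthLT (1 / 4) g) :
    MemLp (berezinInv f g) 2 (gaussian n) := by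
  refine GrowthLT.memLp_two ((hfgrowth.berezinInv (by norm_num) hggrowth).mono (by norm_num)) ?_
  have hcont : Continuous fun p : (Fin n → ℂ) × (Fin n → ℂ) =>
      f (p.1 - p.2) * conj (g (p.1 + p.2)) := by fun_prop
  exact hcont.stronglyMeasurable.integral_prod_right'.aestronglyMeasurable

lemma berezin_berezinInv (hf : Differentiable ℂ f) (hfgrowth : GrowthLT (1 / 2) f)
    (hg : Differentiable ℂ g) (hggrowth : GrowthLT (1 / 2) g) (z : Fin n → ℂ) :
    berezin (berezinInv f g) z = f z * conj (g z) := by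
  have hdilate {h : (Fin n → ℂ) → ℂ} (hh : Differentiable ℂ h) :
      Differentiable ℂ fun w => h (z + √2 • w) := by
    simp only [← Complex.coe_smul]
    fun_prop
  have hgrowth {h : (Fin n → ℂ) → ℂ} (hh : GrowthLT (1 / 2) h) :
      GrowthLT 1 fun w => h (z + √2 • w) := by
    simpa using (hh.comp_add_left z).comp_smul (t := √2) (by positivity)
  let F (p : (Fin n → ℂ) × (Fin n → ℂ)) : ℂ := conj (g (z + √2 • p.1)) * f (z + √2 • p.2)
  have hF : Integrable F ((gaussian n).prod (gaussian n)) :=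
    ((hgrowth hggrowth).conjugate.integrable (Complex.continuous_conj.comp
      (hdilate hg).continuous).aestronglyMeasurable).mul_prod
      ((hgrowth hfgrowth).integrable (hdilate hf).continuous.aestronglyMeasurable)
  have hhadamard (v x : Fin n → ℂ) :
      F (hadamard _ (v, x)) = f (z + v - x) * conj (g (z + v + x)) := by
    simp only [F, hadamard_apply, smul_inv_smul₀ (by positivity : √2 ≠ 0)]
    rw [add_sub_assoc, add_assoc, mul_comm]
  have hmp := measurePreserving_hadamard_gaussian (n := n)
  calc berezin (berezinInv f g) z
      = ∫ v, ∫ x, F (hadamard _ (v, x)) ∂(gaussian n) ∂(gaussian n) := by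
        simp only [berezin_eq_integral_translate, berezinInv, hhadamard]
    _ = ∫ p, F (hadamard _ p) ∂(gaussian n).prod (gaussian n) :=
        (integral_prod _ (hmp.integrable_comp_of_integrable hF)).symm
    _ = ∫ p, F p ∂(gaussian n).prod (gaussian n) := by
        have hm := hF.aestronglyMeasurable
        rw [← hmp.map_eq] at hm
        rw [← integral_map hmp.measurable.aemeasurable hm, hmp.map_eq]
    _ = conj (g z) * f z := by
        simp only [F]
        rw [integral_prod_mul (fun w => conj (g (z + √2 • w))) fun w => f (z + √2 • w),
          integral_conj, integral_gaussian_entire (hdilate hg) (hgrowth hggrowth),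
          integral_gaussian_entire (hdilate hf) (hgrowth hfgrowth)]
        simp
    _ = f z * conj (g z) := mul_comm _ _

end Berezin

section ExponentialMoments

variable {E : Type*} [NormedAddCommGroup E] [NormedSpace ℝ E] [CompleteSpace E]
  [SecondCountableTopology E] [MeasurableSpace E] [BorelSpace E]

lemma measure_eq_of_integral_exp_eq {m₁ m₂ : Measure E} [IsFiniteMeasure m₁] [IsFiniteMeasure m₂]
    (hint : ∀ L : StrongDual ℝ E, Integrable (fun w => Real.exp (L w)) m₁)
    (h : ∀ L : StrongDual ℝ E, ∫ w, Real.exp (L w) ∂m₁ = ∫ w, Real.exp (L w) ∂m₂) :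
    m₁ = m₂ := by
  refine Measure.ext_of_charFunDual (funext fun L => ?_)
  have hmgf : mgf L m₁ = mgf L m₂ := by
    funext t
    simpa [mgf] using h (t • L)
  have hzero : m₁ = 0 ↔ m₂ = 0 := by
    have hmass : m₁.real Set.univ = m₂.real Set.univ := by simpa using h 0
    rw [← Measure.measure_univ_eq_zero, ← Measure.measure_univ_eq_zero (μ := m₂),
      ← measureReal_eq_zero_iff, ← measureReal_eq_zero_iff, hmass]
  have hset : integrableExpSet L m₁ = Set.univ := by
    ext t
    simpa [integrableExpSet] using hint (t • L)
  have hmgf_I := eqOn_complexMGF_of_mgf' hmgf hzero (x := Complex.I) (by simp [hset])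
  rw [charFunDual_apply, charFunDual_apply]
  simpa only [complexMGF, mul_comm] using hmgf_I

variable {ν : Measure E}

lemma ae_eq_zero_of_integral_mul_exp_eq_zero {v : E → ℝ}
    (hint : ∀ L : StrongDual ℝ E, Integrable (fun w => v w * Real.exp (L w)) ν)
    (h : ∀ L : StrongDual ℝ E, ∫ w, v w * Real.exp (L w) ∂ν = 0) : v =ᵐ[ν] 0 := by
  have hv : Integrable v ν := by simpa using hint 0
  have habs : Integrable (fun w => |v w|) ν := hv.abs
  have hadd : Integrable (fun w => |v w| + v w) ν := habs.add hv
  have hadd_nonneg (w : E) : 0 ≤ |v w| + v w := by linarith [neg_abs_le (v w)]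
  have habs_exp (L : StrongDual ℝ E) : Integrable (fun w => |v w| * Real.exp (L w)) ν := by
    simpa [abs_mul] using (hint L).abs
  have hρ₁ : AEMeasurable (fun w => ENNReal.ofReal (|v w| + v w)) ν :=
    hadd.aemeasurable.ennreal_ofReal
  have hρ₂ : AEMeasurable (fun w => ENNReal.ofReal |v w|) ν := habs.aemeasurable.ennreal_ofReal
  have := isFiniteMeasure_withDensity_ofReal hadd.2
  have := isFiniteMeasure_withDensity_ofReal habs.2
  have heq : ν.withDensity (fun w => ENNReal.ofReal (|v w| + v w))
      = ν.withDensity fun w => ENNReal.ofReal |v w| := by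
    refine measure_eq_of_integral_exp_eq (fun L => ?_) fun L => ?_
    · rw [integrable_withDensity_iff_integrable_smul₀' hρ₁ (by simp)]
      simpa [ENNReal.toReal_ofReal (hadd_nonneg _), add_mul] using (habs_exp L).fun_add (hint L)
    · rw [integral_withDensity_eq_integral_toReal_smul₀ hρ₁ (by simp),
        integral_withDensity_eq_integral_toReal_smul₀ hρ₂ (by simp)]
      simp only [ENNReal.toReal_ofReal (hadd_nonneg _), ENNReal.toReal_ofReal (abs_nonneg _),
        smul_eq_mul, add_mul]
      rw [integral_add (habs_exp L) (hint L), h, add_zero]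
  rw [withDensity_eq_iff hρ₁ hρ₂ hadd.lintegral_lt_top.ne] at heq
  filter_upwards [heq] with w hw
  rwa [ENNReal.ofReal_eq_ofReal_iff (hadd_nonneg w) (abs_nonneg _), add_eq_left] at hw

lemma ae_eq_zero_of_integral_mul_ofReal_exp_eq_zero {u : E → ℂ}
    (hint : ∀ L : StrongDual ℝ E, Integrable (fun w => u w * (Real.exp (L w) : ℂ)) ν)
    (h : ∀ L : StrongDual ℝ E, ∫ w, u w * (Real.exp (L w) : ℂ) ∂ν = 0) : u =ᵐ[ν] 0 := by
  have hre : (fun w => (u w).re) =ᵐ[ν] 0 :=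
    ae_eq_zero_of_integral_mul_exp_eq_zero
      (fun L => by simpa only [RCLike.re_eq_complex_re, Complex.re_mul_ofReal] using (hint L).re)
      fun L => by
        simpa only [RCLike.re_eq_complex_re, Complex.re_mul_ofReal, h, Complex.zero_re]
          using integral_re (hint L)
  have him : (fun w => (u w).im) =ᵐ[ν] 0 :=
    ae_eq_zero_of_integral_mul_exp_eq_zero
      (fun L => by simpa only [RCLike.im_eq_complex_im, Complex.im_mul_ofReal] using (hint L).im)
      fun L => by
        simpa only [RCLike.im_eq_complex_im, Complex.im_mul_ofReal, h, Complex.zero_im]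
          using integral_im (hint L)
  filter_upwards [hre, him] with w hw_re hw_im
  exact Complex.ext hw_re hw_im

end ExponentialMoments

section Injectivity

variable {u v : (Fin n → ℂ) → ℂ}

lemma exists_herm_add_herm_eq (L : StrongDual ℝ (Fin n → ℂ)) :
    ∃ z, ∀ w, herm w z + herm z w = (L w : ℂ) := by
  refine ⟨fun k => ⟨L (Pi.single k 1) / 2, L (Pi.single k Complex.I) / 2⟩, fun w => ?_⟩
  have hsingle (k : Fin n) : (Pi.single k (w k) : Fin n → ℂ)
      = (w k).re • (Pi.single k 1 : Fin n → ℂ)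
        + (w k).im • (Pi.single k Complex.I : Fin n → ℂ) := by
    rw [← Pi.single_smul, ← Pi.single_smul, ← Pi.single_add]
    simp [Complex.re_add_im]
  have hL : L w = ∑ k, ((w k).re * L (Pi.single k 1) + (w k).im * L (Pi.single k Complex.I)) := by
    conv_lhs => rw [← Finset.univ_sum_single w]
    simp only [hsingle, map_sum, map_add, map_smul, smul_eq_mul]
  rw [hL]
  simp only [herm, ← Finset.sum_add_distrib, Complex.ofReal_sum]
  refine Finset.sum_congr rfl fun k _ => ?_
  apply Complex.ext
  · simp only [Complex.add_re, Complex.mul_re, Complex.conj_re, Complex.conj_im, Complex.ofReal_re]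
    ring
  · simp only [Complex.add_im, Complex.mul_im, Complex.conj_re, Complex.conj_im, Complex.ofReal_im]
    ring

lemma integrable_mul_exp_herm_add_herm (hu : MemLp u 2 (gaussian n)) (z : Fin n → ℂ) :
    Integrable (fun w => u w * Complex.exp (herm w z + herm z w)) (gaussian n) := by
  have hexp : GrowthLT (1 / 2) fun w => Complex.exp (herm w z + herm z w) := by
    simp_rw [Complex.exp_add]
    exact (growthLT_cexp_herm_left z one_half_pos).mul_of_forall_pos fun _ =>
      growthLT_cexp_herm_right z
  exact hu.integrable_mul (hexp.memLp_two (Continuous.aestronglyMeasurable (by fun_prop)))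

lemma berezin_sub (hu : MemLp u 2 (gaussian n)) (hv : MemLp v 2 (gaussian n)) :
    berezin (u - v) = berezin u - berezin v := by
  funext z
  simp only [Pi.sub_apply, berezin_eq_integral_mul_exp, sub_mul, ← mul_sub]
  rw [integral_sub (integrable_mul_exp_herm_add_herm hu z) (integrable_mul_exp_herm_add_herm hv z)]

lemma berezin_sum {ι : Type*} {s : Finset ι} {u : ι → (Fin n → ℂ) → ℂ}
    (hu : ∀ i ∈ s, MemLp (u i) 2 (gaussian n)) (z : Fin n → ℂ) :
    berezin (fun w => ∑ i ∈ s, u i w) z = ∑ i ∈ s, berezin (u i) z := by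
  simp only [berezin_eq_integral_mul_exp, Finset.sum_mul, ← Finset.mul_sum]
  rw [integral_finsetSum _ fun i hi => integrable_mul_exp_herm_add_herm (hu i hi) z]

lemma ae_eq_zero_of_berezin_eq_zero (hu : MemLp u 2 (gaussian n)) (h : berezin u = 0) :
    u =ᵐ[gaussian n] 0 := by
  refine ae_eq_zero_of_integral_mul_ofReal_exp_eq_zero (fun L => ?_) fun L => ?_
  all_goals
    obtain ⟨z, hz⟩ := exists_herm_add_herm_eq L
    simp only [Complex.ofReal_exp, ← hz]
  · exact integrable_mul_exp_herm_add_herm hu z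
  · have hzero := congrFun h z
    rw [berezin_eq_integral_mul_exp] at hzero
    exact (mul_eq_zero.1 hzero).resolve_left (Complex.exp_ne_zero _)

lemma ae_eq_of_berezin_eq (hu : MemLp u 2 (gaussian n)) (hv : MemLp v 2 (gaussian n))
    (h : berezin u = berezin v) : u =ᵐ[gaussian n] v :=
  sub_ae_eq_zero _ _ |>.1 <|
    ae_eq_zero_of_berezin_eq_zero (hu.sub hv) (by rw [berezin_sub hu hv, h, sub_self])

end Injectivity

end Fock

theorem mainTheorem2_general (n N : ℕ) (f g : Fin N → (Fin n → ℂ) → ℂ) {c : ℝ} (hc : c < 1 / 4)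
    (hf : ∀ l, f l ∈ {h | Differentiable ℂ h} ∩ Fock.growthSpace n c)
    (hg : ∀ l, g l ∈ {h | Differentiable ℂ h} ∩ Fock.growthSpace n c) :
    (∀ l ζ, Summable (Fock.opTerm (Fock.conjStar (g l)) (f l) ζ)) ∧
    (∀ u : (Fin n → ℂ) → ℂ, MemLp u 2 (Fock.gaussian n) →
      (∀ z, Fock.berezin u z = ∑ l, f l z * conj (g l z)) →
      u =ᵐ[Fock.gaussian n] fun ζ => ∑ l, Fock.opApply (Fock.conjStar (g l)) (f l) ζ) ∧
    MemLp (fun ζ => ∑ l, Fock.opApply (Fock.conjStar (g l)) (f l) ζ) 2 (Fock.gaussian n) ∧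
    ∀ z, Fock.berezin (fun ζ => ∑ l, Fock.opApply (Fock.conjStar (g l)) (f l) ζ) z =
      ∑ l, f l z * conj (g l z) := by
  have hgrowth_quarter {h : (Fin n → ℂ) → ℂ}
      (hh : h ∈ {h | Differentiable ℂ h} ∩ Fock.growthSpace n c) :
      Fock.GrowthLT (1 / 4) h := .of_mem_growthSpace hh.2 hh.1.continuous hc
  have hgrowth_half {h : (Fin n → ℂ) → ℂ}
      (hh : h ∈ {h | Differentiable ℂ h} ∩ Fock.growthSpace n c) :
      Fock.GrowthLT (1 / 2) h := (hgrowth_quarter hh).mono (by norm_num)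
  have hsum (l : Fin N) (ζ : Fin n → ℂ) :=
    Fock.hasSum_opTerm (hf l).1 (hgrowth_half (hf l)) (hg l).1 (hgrowth_half (hg l)) ζ
  have hop (l : Fin N) :
      Fock.opApply (Fock.conjStar (g l)) (f l) = Fock.berezinInv (f l) (g l) :=
    funext fun ζ => (hsum l ζ).tsum_eq
  have hmem (l : Fin N) : MemLp (Fock.berezinInv (f l) (g l)) 2 (Fock.gaussian n) :=
    Fock.memLp_berezinInv (hf l).1.continuous (hgrowth_quarter (hf l)) (hg l).1.continuous
      (hgrowth_quarter (hg l))
  have hmem_sum := memLp_finsetSum Finset.univ fun l _ => hmem l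
  have hberezin (z : Fin n → ℂ) :
      Fock.berezin (fun ζ => ∑ l, Fock.berezinInv (f l) (g l) ζ) z = ∑ l, f l z * conj (g l z) := by
    rw [Fock.berezin_sum fun l _ => hmem l]
    exact Finset.sum_congr rfl fun l _ =>
      Fock.berezin_berezinInv (hf l).1 (hgrowth_half (hf l)) (hg l).1 (hgrowth_half (hg l)) z
  simp only [hop]
  exact ⟨fun l ζ => (hsum l ζ).summable, fun u hu hB =>
    Fock.ae_eq_of_berezin_eq hu hmem_sum (funext fun z => (hB z).trans (hberezin z).symm),
    hmem_sum, hberezin⟩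

theorem mainTheorem2 (n N : ℕ) (f g : Fin N → (Fin n → ℂ) → ℂ)
    (hf : ∀ l, f l ∈ Fock.entireSym n) (hg : ∀ l, g l ∈ Fock.entireSym n) :
    -- the series defining `g_l*(ζ̄ - ∂_ζ) f_l(ζ)` converge (absolutely) at every point
    (∀ l ζ, Summable (Fock.opTerm (Fock.conjStar (g l)) (f l) ζ)) ∧
    -- every `L²` solution of `B[u] = ∑ f_l ḡ_l` is given by the formula
    (∀ u : (Fin n → ℂ) → ℂ, MemLp u 2 (Fock.gaussian n) →
      (∀ z, Fock.berezin u z = ∑ l, f l z * conj (g l z)) →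
      u =ᵐ[Fock.gaussian n] fun ζ => ∑ l, Fock.opApply (Fock.conjStar (g l)) (f l) ζ) ∧
    -- conversely, the formula gives an `L²` solution
    MemLp (fun ζ => ∑ l, Fock.opApply (Fock.conjStar (g l)) (f l) ζ) 2 (Fock.gaussian n) ∧
    ∀ z, Fock.berezin (fun ζ => ∑ l, Fock.opApply (Fock.conjStar (g l)) (f l) ζ) z =
      ∑ l, f l z * conj (g l z) :=
  have hsub : Fock.symSpace n ⊆ Fock.growthSpace n (1 / 8) := Set.iInter₂_subset _ (by norm_num)
  mainTheorem2_general n N f g (by norm_num) (fun l => ⟨(hf l).1, hsub (hf l).2⟩)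
    fun l => ⟨(hg l).1, hsub (hg l).2⟩
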